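/- Let $n\ge 3$, let $U\subset\mathbb{C}^n$ be an open neighbourhood of $0$ (for instance $U=\mathbb{C}^n$), and let $F:\mathbb{C}^n\to\mathbb{R}$ be a real polynomial of degree two in $\mathrm{Re}\,z_1,\mathrm{Im}\,z_1,\dots,\mathrm{Re}\,z_n,\mathrm{Im}\,z_n$. Put $$M=\{z\in U: F(z)=0\},\qquad \mathrm{Sing}(M)=M\cap\{dF=0\},\qquad M^*=M\setminus\{dF=0\},$$ and suppose that $M$ is a real hypersurface in the sense that $M^*\neq\emptyset$. Suppose that $M$ is Levi-flat, that is, the Levi distribution $L_p=\ker\partial F(p)\subset T_pM^*=\ker dF(p)$, $p\in M^*$, is integrable in the sense of Frobenius (the Lie bracket of two smooth local vector fields on $M^*$ tangent to $L$ is tangent to $L$). Suppose moreover that $$\mathrm{Sing}(M)=\{z_1=z_2=\dots=z_{n-1}=0\}\cap U .$$ In $\mathbb{C}^n$ consider the quadrics $$Q_{0,2k}=\{\mathrm{Re}(z_1^2+\dots+z_k^2)=0\}\ (1\le k\le n),\qquad Q_{2,4}=\{z_1\bar z_2-\bar z_1z_2=0\}.$$ Call $M$ biholomorphically equivalent to $Q$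 if there is a biholomorphism $\Phi$ of $\mathbb{C}^n$ onto itself with $\Phi(0)=0$ and $\Phi(M)=Q\cap\Phi(U)$ (so $\Phi(M)=Q$ if $U=\mathbb{C}^n$). Then: 1. If $n=3$, then $M$ is biholomorphically equivalent to $Q_{0,4}=\{\mathrm{Re}(z_1^2+z_2^2)=0\}$ or to $Q_{2,4}=\{z_1\bar z_2-\bar z_1z_2=0\}$. 2. If $n\ge 4$, then $M$ is biholomorphically equivalent to $Q_{0,2(n-1)}=\{\mathrm{Re}(z_1^2+\dots+z_{n-1}^2)=0\}$. -/

import Mathlib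

namespace LeviFlat

/-- The real coordinates `(Re z, Im z)` of a point `z` of `ℂⁿ`. -/
def realCoords {n : ℕ} (z : Fin n → ℂ) : Fin n ⊕ Fin n → ℝ :=
  Sum.elim (fun i => (z i).re) (fun i => (z i).im)

/-- `F : ℂⁿ → ℝ` is a real polynomial of degree two in the real coordinates
(not assumed to be homogeneous). -/
def IsQuadratic {n : ℕ} (F : (Fin n → ℂ) → ℝ) : Prop :=
  ∃ P : MvPolynomial (Fin n ⊕ Fin n) ℝ, P.totalDegree = 2 ∧
    ∀ z, F z = MvPolynomial.eval (realCoords z) P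

/-- The zero set `M = {F = 0}` in the open set `U`. -/
def zeroSet {n : ℕ} (F : (Fin n → ℂ) → ℝ) (U : Set (Fin n → ℂ)) : Set (Fin n → ℂ) :=
  {z | z ∈ U ∧ F z = 0}

/-- The singular set `Sing(M) = {F = 0} ∩ {dF = 0}`. -/
def singularSet {n : ℕ} (F : (Fin n → ℂ) → ℝ) (U : Set (Fin n → ℂ)) : Set (Fin n → ℂ) :=
  {z | z ∈ zeroSet F U ∧ fderiv ℝ F z = 0}

/-- The regular part `M* = {F = 0} \ {dF = 0}`. -/
def regularPart {n : ℕ} (F : (Fin n → ℂ) → ℝ) (U : Set (Fin n → ℂ)) : Set (Fin n → ℂ) :=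
  {z | z ∈ zeroSet F U ∧ fderiv ℝ F z ≠ 0}

/-- The `(1,0)`-part `∂F(p)` of the real differential `dF(p)`, that is
`∂F(p) v = (dF(p) v - i dF(p) (i v)) / 2`, which is `∑ⱼ (∂F/∂zⱼ)(p) vⱼ`. -/
noncomputable def del {n : ℕ} (F : (Fin n → ℂ) → ℝ) (p v : Fin n → ℂ) : ℂ :=
  (((fderiv ℝ F p v : ℝ) : ℂ) - Complex.I * ((fderiv ℝ F p (Complex.I • v) : ℝ) : ℂ)) / 2

/-- The Levi distribution `L_p = ker ∂F(p)`. For `p` in the regular part it is the complex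
hyperplane contained in the tangent space `ker dF(p)`. -/
def leviDistribution {n : ℕ} (F : (Fin n → ℂ) → ℝ) (p : Fin n → ℂ) : Set (Fin n → ℂ) :=
  {v | del F p v = 0}

/-- `M = {F = 0}` is Levi-flat: the Levi distribution on `M*` is integrable in the sense of
Frobenius, i.e. the Lie bracket of two smooth local (real) vector fields that belong to the
Levi distribution along `M*` again belongs to it along `M*`. Vector fields on the embedded
submanifold `M*` are given by smooth local extensions to the ambient space. -/
def IsLeviFlat {n : ℕ} (F : (Fin n → ℂ) → ℝ) (U : Set (Fin n → ℂ)) : Prop :=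
  ∀ (V : Set (Fin n → ℂ)) (X Y : (Fin n → ℂ) → (Fin n → ℂ)), IsOpen V →
    ContDiffOn ℝ (⊤ : ℕ∞) X V → ContDiffOn ℝ (⊤ : ℕ∞) Y V →
    (∀ p ∈ regularPart F U ∩ V, X p ∈ leviDistribution F p ∧ Y p ∈ leviDistribution F p) →
    ∀ p ∈ regularPart F U ∩ V, VectorField.lieBracket ℝ X Y p ∈ leviDistribution F p

/-- The complex line `{z₁ = … = z_{n-1} = 0}` in `ℂⁿ`. -/
def complexLine (n : ℕ) : Set (Fin n → ℂ) :=
  {z | ∀ i : Fin n, (i : ℕ) < n - 1 → z i = 0}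

/-- The quadric `Q_{0,2k} = {Re (z₁² + … + z_k²) = 0}` in `ℂⁿ`. -/
def Q0 (n k : ℕ) : Set (Fin n → ℂ) :=
  {z | (∑ i : Fin n, if (i : ℕ) < k then z i ^ 2 else 0).re = 0}

/-- The quadric `Q_{2,4} = {z₁ z̄₂ - z̄₁ z₂ = 0}` in `ℂⁿ`, where `n ≥ 2`. -/
def Q24 (n : ℕ) (hn : 2 ≤ n) : Set (Fin n → ℂ) :=
  {z | z ⟨0, by omega⟩ * (starRingEnd ℂ) (z ⟨1, by omega⟩) -
    (starRingEnd ℂ) (z ⟨0, by omega⟩) * z ⟨1, by omega⟩ = 0}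

/-- The hypersurface `M` in `U` is carried onto the part of `Q` in the image of `U` by a
biholomorphism of `ℂⁿ` that fixes the origin. For `U = ℂⁿ` it carries `M` onto `Q`; in
general it identifies the germs of `M` and `Q` at the origin. -/
def BiholomorphicTo {n : ℕ} (U M Q : Set (Fin n → ℂ)) : Prop :=
  ∃ Φ : (Fin n → ℂ) ≃ (Fin n → ℂ), Differentiable ℂ Φ ∧ Differentiable ℂ Φ.symm ∧
    Φ 0 = 0 ∧ Φ '' M = Q ∩ Φ '' U

end LeviFlat

/-! The origin is singular, so `F z = B z z` with `B` real symmetric. The covector `A_p = ∂F(p)`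
(`leviCovector`) is `S(p,·) + H(p,·)` with `S` complex symmetric and `H` Hermitian, hence `F z = Re
S(z,z) + H(z,z)`. The kernel of `B` is the given complex line, and Levi-flatness says that `H`
vanishes on the hyperplane `ker A_p` at every regular zero `p` (`levi_condition`).

If `H ≠ 0`, the kernel of `H` lies in that of `B` (`ker_hermitianPart`), so it is at most a line. An
isotropic hyperplane contains kernel vectors of `H` in codimension at most two, which is impossible
for `n ≥ 4` (`hermitianPart_eq_zero`). Thus `H = 0`, and diagonalizing `S` gives `Q0`
(`biholomorphicTo_Q0`).

For `n = 3` and `H ≠ 0` there is a hyperbolic pair for `H`. The Levi form vanishes on the zeros of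
the indefinite form `B`, so it is a multiple of it; comparing coefficients forces `S = 0`
(`binary_levi`), which leaves `Q24`. -/

namespace LeviFlat

open Complex ComplexConjugate

/-! ### Hermitian and complex symmetric parts of a real quadratic form. -/

section Algebra

variable {E : Type*} [AddCommGroup E] [Module ℂ E] [Module ℝ E] [IsScalarTower ℝ ℂ E]

/-- The `(1,0)`-part `v ↦ B(p, v) - i B(p, i v)` of the real covector `B(p, ·)`. -/
noncomputable def leviCovector (B : E →ₗ[ℝ] E →ₗ[ℝ] ℝ) (p : E) : E →ₗ[ℂ] ℂ where
  toFun v := (B p v : ℂ) - I * (B p (I • v) : ℂ)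
  map_add' v w := by
    simp only [smul_add, map_add, ofReal_add]; ring
  map_smul' c v := by
    have h1 : c • v = c.re • v + c.im • (I • v) := by
      conv_lhs => rw [← re_add_im c]
      rw [add_smul, mul_smul, ← algebraMap_smul ℂ c.re v, ← algebraMap_smul ℂ c.im (I • v)]
      rfl
    have h2 : I • c • v = c.re • (I • v) - c.im • v := by
      rw [h1, smul_add, smul_comm I c.re v, smul_comm I c.im (I • v), smul_smul I I, I_mul_I,
        neg_one_smul, smul_neg, sub_eq_add_neg]
    simp only [h2]
    rw [h1]
    simp only [map_add, map_sub, map_smul, smul_eq_mul, ofReal_add, ofReal_sub, ofReal_mul,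
      RingHom.id_apply]
    conv_rhs => rw [← re_add_im c]
    linear_combination (c.im * B p (I • v) : ℂ) * I_sq

variable (B : E →ₗ[ℝ] E →ₗ[ℝ] ℝ)

lemma leviCovector_apply (p v : E) :
    leviCovector B p v = (B p v : ℂ) - I * (B p (I • v) : ℂ) := rfl

lemma leviCovector_add (p q v : E) :
    leviCovector B (p + q) v = leviCovector B p v + leviCovector B q v := by
  simp only [leviCovector_apply, map_add, LinearMap.add_apply, ofReal_add]; ring

lemma leviCovector_smul (t : ℝ) (p v : E) :
    leviCovector B (t • p) v = t * leviCovector B p v := by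
  simp only [leviCovector_apply, map_smul, LinearMap.smul_apply, smul_eq_mul, ofReal_mul]; ring

lemma leviCovector_re (p v : E) : (leviCovector B p v).re = B p v := by
  simp [leviCovector_apply]

lemma leviCovector_I_I (p v : E) : leviCovector B (I • I • p) v = -leviCovector B p v := by
  have : I • I • p = (-1 : ℝ) • p := by
    rw [smul_smul, I_mul_I, neg_one_smul, neg_one_smul]
  rw [this, leviCovector_smul]; simp

/-- The Hermitian part of the quadratic form `B(z, z)`, conjugate-linear in the first variable. -/
noncomputable def hermitianPart (p : E) : E →ₗ[ℂ] ℂ :=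
  (1 / 2 : ℂ) • (leviCovector B p + I • leviCovector B (I • p))

/-- The complex symmetric part of the quadratic form `B(z, z)`. -/
noncomputable def symmetricPart : E →ₗ[ℂ] E →ₗ[ℂ] ℂ where
  toFun p := (1 / 2 : ℂ) • (leviCovector B p - I • leviCovector B (I • p))
  map_add' p q := by
    ext v
    simp only [smul_add, LinearMap.smul_apply, LinearMap.sub_apply, LinearMap.add_apply,
      leviCovector_add, smul_eq_mul]; ring
  map_smul' c p := by
    have h1 : c • p = c.re • p + c.im • (I • p) := by
      conv_lhs => rw [← re_add_im c]
      rw [add_smul, mul_smul, ← algebraMap_smul ℂ c.re p, ← algebraMap_smul ℂ c.im (I • p)]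
      rfl
    have h2 : I • c • p = c.re • (I • p) + c.im • (I • I • p) := by
      rw [h1, smul_add, smul_comm I c.re p, smul_comm I c.im (I • p)]
    ext v
    simp only [h2]
    rw [h1]
    simp only [LinearMap.smul_apply, LinearMap.sub_apply, leviCovector_add, leviCovector_smul,
      leviCovector_I_I, smul_eq_mul, RingHom.id_apply]
    conv_rhs => rw [← re_add_im c]
    linear_combination (1 / 2 : ℂ) * c.im * leviCovector B (I • p) v * I_sq

lemma hermitianPart_apply (p v : E) : hermitianPart B p v =
    1 / 2 * (leviCovector B p v + I * leviCovector B (I • p) v) := rfl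

lemma symmetricPart_apply (p v : E) : symmetricPart B p v =
    1 / 2 * (leviCovector B p v - I * leviCovector B (I • p) v) := rfl

lemma symmetricPart_add_hermitianPart (p v : E) :
    symmetricPart B p v + hermitianPart B p v = leviCovector B p v := by
  rw [hermitianPart_apply, symmetricPart_apply]; ring

variable {B}

lemma hermitianPart_conj (hB : ∀ x y, B x y = B y x) (p v : E) :
    conj (hermitianPart B p v) = hermitianPart B v p := by
  have h1 : B (I • p) (I • v) = B (I • v) (I • p) := hB _ _
  have h2 : B (I • p) v = B v (I • p) := hB _ _
  have h3 : B p (I • v) = B (I • v) p := hB _ _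
  have h4 : B p v = B v p := hB _ _
  simp only [hermitianPart_apply, leviCovector_apply, h1, h2, h3, h4, map_mul, map_add, map_sub,
    conj_ofReal, conj_I, map_div₀, map_one, map_ofNat]
  ring

lemma symmetricPart_symm (hB : ∀ x y, B x y = B y x) (p v : E) :
    symmetricPart B p v = symmetricPart B v p := by
  have h1 : B (I • p) (I • v) = B (I • v) (I • p) := hB _ _
  have h2 : B (I • p) v = B v (I • p) := hB _ _
  have h3 : B p (I • v) = B (I • v) p := hB _ _
  have h4 : B p v = B v p := hB _ _
  simp only [symmetricPart_apply, leviCovector_apply, h1, h2, h3, h4]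
  ring

lemma hermitianPart_add_left (hB : ∀ x y, B x y = B y x) (p q v : E) :
    hermitianPart B (p + q) v = hermitianPart B p v + hermitianPart B q v := by
  rw [← hermitianPart_conj hB, map_add, map_add, hermitianPart_conj hB, hermitianPart_conj hB]

lemma hermitianPart_smul_left (hB : ∀ x y, B x y = B y x) (c : ℂ) (p v : E) :
    hermitianPart B (c • p) v = conj c * hermitianPart B p v := by
  rw [← hermitianPart_conj hB, map_smul, smul_eq_mul, map_mul, hermitianPart_conj hB]

lemma apply_eq_zero_of_leviCovector_eq_zero {p : E} (h : ∀ v, leviCovector B p v = 0) (v : E) :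
    B p v = 0 := by
  rw [← leviCovector_re, h, zero_re]

lemma leviCovector_eq_zero {p : E} (h : ∀ v, B p v = 0) (v : E) : leviCovector B p v = 0 := by
  simp [leviCovector_apply, h]

/-- An isotropic subspace for a Hermitian form is totally isotropic. -/
lemma hermitianPart_polarization (hB : ∀ x y, B x y = B y x) (W : Submodule ℂ E)
    (h : ∀ w ∈ W, hermitianPart B w w = 0) {v w : E} (hv : v ∈ W) (hw : w ∈ W) :
    hermitianPart B v w = 0 := by
  -- Isotropy of `v + w` kills the real part of `H(v,w)`, that of `v + i w` the imaginary part.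
  have h1 := h (v + w) (W.add_mem hv hw)
  have h2 := h (v + I • w) (W.add_mem hv (W.smul_mem I hw))
  simp only [hermitianPart_add_left hB, hermitianPart_smul_left hB, map_add, map_smul,
    smul_eq_mul, h v hv, h w hw, conj_I] at h1 h2
  linear_combination (1 / 2 : ℂ) * h1 - (1 / 2 : ℂ) * I * h2 +
    (1 / 2 : ℂ) * (hermitianPart B v w - hermitianPart B w v) * I_sq

end Algebra

/-! ### Zeros of indefinite real quadratic forms. -/

section RealForms

variable {E : Type*} [AddCommGroup E] [Module ℝ E]

/-- A nonsingular zero of a quadratic form makes the form indefinite. -/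
lemma exists_pos_neg (B : E →ₗ[ℝ] E →ₗ[ℝ] ℝ) (hB : ∀ x y, B x y = B y x) {p v : E}
    (hp : B p p = 0) (hv : B p v ≠ 0) : ∃ x y, 0 < B x x ∧ B y y < 0 := by
  -- Since `p` is isotropic, the form is affine in `t` with nonzero slope; the witnesses give the
  -- values `1` and `-1`.
  have key : ∀ t : ℝ, B (t • p + v) (t • p + v) = 2 * t * B p v + B v v := by
    intro t
    simp only [map_add, map_smul, LinearMap.add_apply, LinearMap.smul_apply, smul_eq_mul, hp,
      hB v p]
    ring
  refine ⟨((1 - B v v) / (2 * B p v)) • p + v, ((-1 - B v v) / (2 * B p v)) • p + v, ?_, ?_⟩ <;>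
  · rw [key, show ∀ c : ℝ, 2 * (c / (2 * B p v)) * B p v = c by intro c; field_simp]
    linarith

/-- A quadratic form that vanishes on the zeros of an indefinite quadratic form is a multiple
of it. -/
lemma exists_eq_mul_of_zeros (B G : E →ₗ[ℝ] E →ₗ[ℝ] ℝ) (hB : ∀ x y, B x y = B y x)
    (hG : ∀ p, B p p = 0 → G p p = 0) {a b : E} (ha : 0 < B a a) (hb : B b b < 0) :
    ∃ c : ℝ, ∀ p, G p p = c * B p p := by
  -- The line `x + t y` meets the zeros of `B` at two distinct points. There `G` vanishes too, so
  -- the two quadratic polynomials in `t` are proportional; `cross` compares their constant and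
  -- leading coefficients.
  have cross : ∀ x y, 0 < B x x → B y y < 0 → G x x * B y y = G y y * B x x := by
    intro x y hx hy
    have eB : ∀ t : ℝ, B (x + t • y) (x + t • y) = B x x + 2 * B x y * t + B y y * t ^ 2 := by
      intro t
      simp only [map_add, map_smul, LinearMap.add_apply, LinearMap.smul_apply, smul_eq_mul,
        hB y x]
      ring
    have eG : ∀ t : ℝ, G (x + t • y) (x + t • y) =
        G x x + (G x y + G y x) * t + G y y * t ^ 2 := by
      intro t
      simp only [map_add, map_smul, LinearMap.add_apply, LinearMap.smul_apply, smul_eq_mul]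
      ring
    have hxy := mul_neg_of_pos_of_neg hx hy
    set D := B x y ^ 2 - B x x * B y y with hD
    have hDpos : 0 < D := by nlinarith [sq_nonneg (B x y)]
    set s := Real.sqrt D
    have hs : s ^ 2 = D := Real.sq_sqrt hDpos.le
    have hspos : 0 < s := Real.sqrt_pos.2 hDpos
    have root : ∀ r : ℝ, r ^ 2 = D → G x x * B y y ^ 2 + (G x y + G y x) * (-B x y + r) * B y y
        + G y y * (-B x y + r) ^ 2 = 0 := by
      intro r hr
      have hne := hy.ne
      have h0 := hG (x + ((-B x y + r) / B y y) • y) (by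
        rw [eB]; field_simp; linear_combination hr + hD)
      rw [eG] at h0
      field_simp at h0
      linear_combination h0
    have h1 := root s hs
    have h2 := root (-s) (by rw [neg_sq, hs])
    have h3 : (G x y + G y x) * B y y = 2 * G y y * B x y := by
      apply mul_left_cancel₀ hspos.ne'
      linear_combination (1 / 2) * h1 - (1 / 2) * h2
    apply mul_left_cancel₀ hy.ne
    linear_combination h1 - (-B x y + s) * h3 - G y y * hs - G y y * hD
  have hmul : ∀ {x y : E}, B x x ≠ 0 → G x x * B y y = G y y * B x x →
      G y y = G x x / B x x * B y y := by
    intro x y hx h; field_simp; linarith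
  have hab := cross a b ha hb
  refine ⟨G a a / B a a, fun p => ?_⟩
  rcases lt_trichotomy (B p p) 0 with h | h | h
  · exact hmul ha.ne' (cross a p ha h)
  · rw [h, hG p h, mul_zero]
  · have := cross p b h hb
    have e : G a a / B a a = G b b / B b b := by
      rw [div_eq_div_iff ha.ne' hb.ne]; exact hab
    rw [e]
    exact hmul hb.ne this.symm

/-- The zeros of an indefinite quadratic form span the space. -/
lemma linear_eq_zero_of_zeros (B : E →ₗ[ℝ] E →ₗ[ℝ] ℝ) (hB : ∀ x y, B x y = B y x)
    (l : E →ₗ[ℝ] ℝ) (hl : ∀ p, B p p = 0 → l p = 0) {a b : E} (ha : 0 < B a a)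
    (hb : B b b < 0) (p : E) : l p = 0 := by
  -- The square of `l` is `c B`; being semidefinite while `B` is indefinite, it forces `c = 0`.
  obtain ⟨c, hc⟩ := exists_eq_mul_of_zeros B (l.smulRight l) hB
    (fun p hp => by simp [hl p hp]) ha hb
  simp only [LinearMap.smulRight_apply, LinearMap.smul_apply, smul_eq_mul] at hc
  have h1 := hc a
  have h2 := hc b
  have hc0 : c = 0 := by
    apply le_antisymm
    · by_contra! h; nlinarith [mul_self_nonneg (l b)]
    · by_contra! h; nlinarith [mul_self_nonneg (l a)]
  have := hc p
  rw [hc0, zero_mul] at this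
  exact mul_self_eq_zero.1 this

end RealForms

/-! ### Consequences of Levi-flatness for the Hermitian part. -/

section Algebra

variable {E : Type*} [AddCommGroup E] [Module ℂ E] [Module ℝ E] [IsScalarTower ℝ ℂ E]
  {B : E →ₗ[ℝ] E →ₗ[ℝ] ℝ}

lemma hermitianPart_eq_zero_comm (hB : ∀ x y, B x y = B y x) {u v : E}
    (h : hermitianPart B u v = 0) : hermitianPart B v u = 0 := by
  rw [← hermitianPart_conj hB, h, map_zero]

/-- The Hermitian part of a Levi-flat indefinite form is zero or has the same kernel as the
real form. -/
lemma ker_hermitianPart (hB : ∀ x y, B x y = B y x) {a b : E} (ha : 0 < B a a) (hb : B b b < 0)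
    (hlevi : ∀ p v w, B p p = 0 →
      hermitianPart B (leviCovector B p w • v - leviCovector B p v • w)
        (leviCovector B p w • v - leviCovector B p v • w) = 0)
    {x y : E} (hxy : hermitianPart B x y ≠ 0) {u : E} (hu : ∀ v, hermitianPart B v u = 0)
    (v : E) : B u v = 0 := by
  have key : ∀ p, B p p = 0 → B.flip u p = 0 := by
    intro p hp
    rw [LinearMap.flip_apply, ← leviCovector_re]
    suffices leviCovector B p u = 0 by rw [this, zero_re]
    by_contra hne
    refine hxy (hermitianPart_polarization hB ⊤ (fun z _ => ?_) trivial trivial)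
    -- The vector is `A_p(u) z - A_p(z) u` with `u` in the kernel of `H`, so its Levi form is
    -- `|A_p(u)|² H(z,z)`.
    have h := hlevi p z u hp
    have hu' : ∀ v, hermitianPart B u v = 0 := fun v => hermitianPart_eq_zero_comm hB (hu v)
    simpa [sub_eq_add_neg, ← neg_smul, hermitianPart_add_left hB, hermitianPart_smul_left hB,
      hu, hu', hne] using h
  rw [hB]
  exact linear_eq_zero_of_zeros B hB (B.flip u) key ha hb v

/-- The Levi form vanishes on the Levi distribution. -/
lemma hermitianPart_eq_zero_of_mem_ker (hB : ∀ x y, B x y = B y x)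
    (hlevi : ∀ p v w, B p p = 0 →
      hermitianPart B (leviCovector B p w • v - leviCovector B p v • w)
        (leviCovector B p w • v - leviCovector B p v • w) = 0)
    {p w : E} (hp : B p p = 0) (hw : leviCovector B p w ≠ 0) {u v : E}
    (hu : leviCovector B p u = 0) (hv : leviCovector B p v = 0) : hermitianPart B u v = 0 := by
  refine hermitianPart_polarization hB (LinearMap.ker (leviCovector B p)) (fun z hz => ?_) hu hv
  have h := hlevi p z w hp
  rw [LinearMap.mem_ker.1 hz] at h
  simpa [hermitianPart_smul_left hB, hw] using h

/-- In dimension at least four, with a one-dimensional kernel, Levi-flatness forces the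
Hermitian part to vanish. -/
lemma hermitianPart_eq_zero [FiniteDimensional ℂ E] (hB : ∀ x y, B x y = B y x)
    (hlevi : ∀ p v w, B p p = 0 →
      hermitianPart B (leviCovector B p w • v - leviCovector B p v • w)
        (leviCovector B p w • v - leviCovector B p v • w) = 0)
    {p q : E} (hp : B p p = 0) (hpq : B p q ≠ 0) (hdim : 4 ≤ Module.finrank ℂ E) {e : E}
    (he : ∀ w, (∀ v, B w v = 0) → w ∈ Submodule.span ℂ {e}) (x y : E) :
    hermitianPart B x y = 0 := by
  by_contra hxy
  obtain ⟨a, b, ha, hb⟩ := exists_pos_neg B hB hp hpq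
  have hq : leviCovector B p q ≠ 0 := by
    intro h; apply hpq; rw [← leviCovector_re, h, zero_re]
  -- Two linear conditions leave a kernel of dimension at least two. A vector in it is
  -- `H`-orthogonal to `ker A_p` and to the complementary vector `q`, hence to everything.
  let f : E →ₗ[ℂ] ℂ × ℂ := (leviCovector B p).prod (hermitianPart B q)
  have hker : LinearMap.ker f ≤ Submodule.span ℂ {e} := by
    intro w hw
    obtain ⟨h1, h2⟩ : leviCovector B p w = 0 ∧ hermitianPart B q w = 0 := by
      simpa [f] using hw
    refine he w (ker_hermitianPart hB ha hb hlevi hxy fun v => ?_)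
    have hv : leviCovector B p (v - (leviCovector B p v / leviCovector B p q) • q) = 0 := by
      simp [hq]
    have h := hermitianPart_eq_zero_of_mem_ker hB hlevi hp hq hv h1
    simpa [sub_eq_add_neg, ← neg_smul, hermitianPart_add_left hB, hermitianPart_smul_left hB,
      h2] using h
  have h0 : Module.finrank ℂ (Submodule.span ℂ {e}) ≤ 1 := by
    simpa using finrank_span_le_card ({e} : Set E)
  have h1 := (Submodule.finrank_mono hker).trans (h0)
  have h2 := f.finrank_range_add_finrank_ker
  have h3 := (LinearMap.range f).finrank_le
  rw [Module.finrank_prod, Module.finrank_self] at h3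
  omega

/-- In dimension three, with a one-dimensional kernel, a Levi-flat form with nonzero Hermitian
part has a hyperbolic pair. -/
lemma exists_hyperbolic_pair [FiniteDimensional ℂ E] (hB : ∀ x y, B x y = B y x)
    (hlevi : ∀ p v w, B p p = 0 →
      hermitianPart B (leviCovector B p w • v - leviCovector B p v • w)
        (leviCovector B p w • v - leviCovector B p v • w) = 0)
    {p q : E} (hp : B p p = 0) (hpq : B p q ≠ 0) (hdim : 3 ≤ Module.finrank ℂ E) {e : E}
    (he : ∀ w, (∀ v, B w v = 0) → w ∈ Submodule.span ℂ {e}) {x y : E}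
    (hxy : hermitianPart B x y ≠ 0) :
    ∃ u v, hermitianPart B u u = 0 ∧ hermitianPart B v v = 0 ∧ hermitianPart B u v = 1 := by
  obtain ⟨a, b, ha, hb⟩ := exists_pos_neg B hB hp hpq
  have hq : leviCovector B p q ≠ 0 := by
    intro h; apply hpq; rw [← leviCovector_re, h, zero_re]
  -- `ker A_p` has dimension at least two, so it is not contained in the line spanned by `e`.
  obtain ⟨u, hu, hue⟩ : ∃ u ∈ LinearMap.ker (leviCovector B p), u ∉ Submodule.span ℂ {e} := by
    by_contra! hker
    have h0 : Module.finrank ℂ (Submodule.span ℂ {e}) ≤ 1 := by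
      simpa using finrank_span_le_card ({e} : Set E)
    have h1 := (Submodule.finrank_mono hker).trans (h0)
    have h2 := (leviCovector B p).finrank_range_add_finrank_ker
    have h3 := (LinearMap.range (leviCovector B p)).finrank_le
    rw [Module.finrank_self] at h3
    omega
  have huu := hermitianPart_eq_zero_of_mem_ker hB hlevi hp hq hu hu
  obtain ⟨v, hv⟩ : ∃ v, hermitianPart B u v ≠ 0 := by
    by_contra! h
    exact hue (he u (ker_hermitianPart hB ha hb hlevi hxy
      fun v => hermitianPart_eq_zero_comm hB (h v)))
  set w := (hermitianPart B u v)⁻¹ • v with hw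
  have huw : hermitianPart B u w = 1 := by simp [hw, hv]
  have hwu : hermitianPart B w u = 1 := by rw [← hermitianPart_conj hB, huw, map_one]
  have hww := hermitianPart_conj hB w w
  -- As `H(w,w)` is real and `H(u,w) = 1`, this shift along the isotropic `u` makes `w` isotropic.
  refine ⟨u, w + (-(hermitianPart B w w) / 2) • u, huu, ?_, by simp [huu, huw]⟩
  simp only [hermitianPart_add_left hB, hermitianPart_smul_left hB, map_add, map_smul, huu, huw,
    hwu, smul_eq_mul, map_div₀, map_neg, hww, map_ofNat]
  ring

end Algebra

/-! ### Coefficient comparison in two complex variables. -/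

section Scalars

/-- Test points suffice: `1` detects the real part of a square coefficient and `1 + i`, whose square
is `2i`, the imaginary part. -/
lemma binary_coeff_eq_zero {s₁ s₂ s₃ : ℂ}
    (h : ∀ x y : ℂ, (s₁ * x ^ 2 + 2 * s₂ * x * y + s₃ * y ^ 2).re = 0) :
    s₁ = 0 ∧ s₂ = 0 ∧ s₃ = 0 := by
  have h1 := h 1 0
  have h2 := h (1 + I) 0
  have h3 := h 0 1
  have h4 := h 0 (1 + I)
  have h5 := h 1 1
  have h6 := h 1 I
  simp [pow_two] at h1 h2 h3 h4 h5 h6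
  refine ⟨?_, ?_, ?_⟩ <;> apply Complex.ext <;> simp <;> linarith

/-- The conclusion says that the antilinear map `T(x,y) = (conj(s₂x + s₃y), conj(s₁x + s₂y))`
satisfies `T² = 1`. -/
lemma binary_levi_of_one {s₁ s₂ s₃ : ℂ}
    (h : ∀ x y : ℂ, ((conj s₂ * conj x + conj s₃ * conj y) * (s₁ * x + s₂ * y)).re =
      (conj x * y).re) :
    conj s₂ * s₂ + conj s₃ * s₁ = 1 ∧ conj s₂ * s₃ + conj s₃ * s₂ = 0 ∧
      conj s₂ * s₁ + conj s₁ * s₂ = 0 := by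
  have h1 := h 1 0
  have h2 := h 0 1
  have h3 := h 1 1
  have h4 := h 1 I
  simp at h1 h2 h3 h4
  refine ⟨?_, ?_, ?_⟩ <;> apply Complex.ext <;> simp <;> linarith

/-- A nondegenerate form `Re (s₁x² + 2s₂xy + s₃y²) + 2 Re (x̄y)` proportional to its Levi form
along the Levi distribution is Hermitian. -/
lemma binary_levi {s₁ s₂ s₃ : ℂ} {c : ℝ}
    (h : ∀ x y : ℂ, (conj (s₂ * x + s₃ * y + conj x) * (s₁ * x + s₂ * y + conj y)).re =
      c * ((s₁ * x ^ 2 + 2 * s₂ * x * y + s₃ * y ^ 2).re + 2 * (conj x * y).re))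
    (hnd : ∀ x y : ℂ, s₁ * x + s₂ * y + conj y = 0 → s₂ * x + s₃ * y + conj x = 0 →
      x = 0 ∧ y = 0) : s₁ = 0 ∧ s₂ = 0 ∧ s₃ = 0 := by
  have hsplit : ∀ x y : ℂ,
      (c - 1) * (s₁ * x ^ 2 + 2 * s₂ * x * y + s₃ * y ^ 2).re = 0 ∧
      ((conj s₂ * conj x + conj s₃ * conj y) * (s₁ * x + s₂ * y)).re =
        (2 * c - 1) * (conj x * y).re := by
    intro x y
    have h1 := h x y
    -- Multiplication by `i` negates the complex symmetric terms and fixes the Hermitian ones, so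
    -- both types separate.
    have h2 := h (I * x) (I * y)
    simp [pow_two, -mul_eq_zero] at h1 h2 ⊢
    constructor
    · linear_combination (h2 - h1) / 2
    · linear_combination (h1 + h2) / 2
  by_cases hc : c = 1
  · exfalso
    subst hc
    obtain ⟨r1, r2, r3⟩ := binary_levi_of_one (s₁ := s₁) (s₂ := s₂) (s₃ := s₃)
      (fun x y => by rw [(hsplit x y).2]; ring)
    have r1' := congrArg conj r1
    have r3' := congrArg conj r3
    simp only [map_add, map_mul, conj_conj, map_one, map_zero] at r1' r3'
    -- The hypothesis `hnd` says that `T z = -z` only for `z = 0`, with `T` antilinear as in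
    -- `binary_levi_of_one`. For `z = (1,0)`, both `z - T z` and `i(z + T z)` are such vectors;
    -- their vanishing gives `2 z = 0`.
    have k1 := hnd (1 - conj s₂) (-conj s₁)
      (by simp only [map_neg, conj_conj]; linear_combination -r3)
      (by simp only [map_sub, conj_conj, map_one]; linear_combination -r1')
    have k2 := hnd (I * (1 + conj s₂)) (I * conj s₁)
      (by simp only [map_mul, conj_conj, conj_I]; linear_combination I * r3)
      (by simp only [map_mul, map_add, conj_conj, map_one, conj_I]; linear_combination I * r1')
    have k3 : 1 + conj s₂ = 0 := by simpa using k2.1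
    have : (2 : ℂ) = 0 := by linear_combination k1.1 + k3
    norm_num at this
  · refine binary_coeff_eq_zero fun x y => ?_
    exact (mul_eq_zero.1 (hsplit x y).1).resolve_left (sub_ne_zero.2 hc)

end Scalars

/-! ### Normal form in dimension three. -/

section Dimension3

variable {E : Type*} [AddCommGroup E] [Module ℂ E] [Module ℝ E] [IsScalarTower ℝ ℂ E]
  {B : E →ₗ[ℝ] E →ₗ[ℝ] ℝ}

lemma leviCovector_right_of_mem_ker (hB : ∀ x y, B x y = B y x) {e : E}
    (he : ∀ c : ℂ, ∀ x, B (c • e) x = 0) (x : E) : leviCovector B x e = 0 := by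
  have h1 : B x e = 0 := by rw [hB]; simpa using he 1 x
  simp [leviCovector_apply, h1, hB x (I • e), he I]

lemma hermitianPart_right_of_mem_ker (hB : ∀ x y, B x y = B y x) {e : E}
    (he : ∀ c : ℂ, ∀ x, B (c • e) x = 0) (x : E) : hermitianPart B x e = 0 := by
  simp [hermitianPart_apply, leviCovector_right_of_mem_ker hB he]

lemma symmetricPart_right_of_mem_ker (hB : ∀ x y, B x y = B y x) {e : E}
    (he : ∀ c : ℂ, ∀ x, B (c • e) x = 0) (x : E) : symmetricPart B x e = 0 := by
  simp [symmetricPart_apply, leviCovector_right_of_mem_ker hB he]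

lemma linearIndependent_hyperbolic (hB : ∀ x y, B x y = B y x) {u v e : E}
    (huu : hermitianPart B u u = 0) (hvv : hermitianPart B v v = 0)
    (huv : hermitianPart B u v = 1) (he0 : e ≠ 0) (he : ∀ c : ℂ, ∀ x, B (c • e) x = 0) :
    LinearIndependent ℂ ![u, v, e] := by
  have hvu : hermitianPart B v u = 1 := by rw [← hermitianPart_conj hB, huv, map_one]
  rw [Fintype.linearIndependent_iff]
  intro g hg
  simp only [Fin.sum_univ_three, Matrix.cons_val_zero, Matrix.cons_val_one, Matrix.cons_val] at hg
  have h1 : g 1 = 0 := by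
    have := congrArg (hermitianPart B u) hg
    simpa [huu, huv, hermitianPart_right_of_mem_ker hB he] using this
  have h0 : g 0 = 0 := by
    have := congrArg (hermitianPart B v) hg
    simpa [hvu, hvv, hermitianPart_right_of_mem_ker hB he] using this
  have h2 : g 2 = 0 := by simpa [h0, h1, he0] using hg
  intro i
  fin_cases i <;> assumption

/-- In dimension three, a Levi-flat form with one-dimensional kernel and nonzero Hermitian part
is linearly equivalent to `2 Re (i z₁ z̄₂)`. -/
lemma exists_basis_hyperbolic [FiniteDimensional ℂ E] (hB : ∀ x y, B x y = B y x)
    (hlevi : ∀ p v w, B p p = 0 →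
      hermitianPart B (leviCovector B p w • v - leviCovector B p v • w)
        (leviCovector B p w • v - leviCovector B p v • w) = 0)
    {p q : E} (hp : B p p = 0) (hpq : B p q ≠ 0) (hdim : Module.finrank ℂ E = 3) {e : E}
    (he0 : e ≠ 0) (hes : ∀ w, (∀ v, B w v = 0) → w ∈ Submodule.span ℂ {e})
    (he : ∀ c : ℂ, ∀ x, B (c • e) x = 0) {x y : E} (hxy : hermitianPart B x y ≠ 0) :
    ∃ b : Module.Basis (Fin 3) ℂ E, ∀ z, B z z = 2 * (b.repr z 0 * conj (b.repr z 1)).im := by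
  obtain ⟨a, b, ha, hb⟩ := exists_pos_neg B hB hp hpq
  obtain ⟨u, v, huu, hvv, huv⟩ := exists_hyperbolic_pair hB hlevi hp hpq hdim.ge hes hxy
  have hvu : hermitianPart B v u = 1 := by rw [← hermitianPart_conj hB, huv, map_one]
  have hhe := hermitianPart_right_of_mem_ker hB he
  have hhe' : ∀ x, hermitianPart B e x = 0 := fun x => hermitianPart_eq_zero_comm hB (hhe x)
  have hse := symmetricPart_right_of_mem_ker hB he
  have hse' : ∀ x, symmetricPart B e x = 0 := fun x => (symmetricPart_symm hB e x).trans (hse x)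
  have hform : ∀ z, B z z = (symmetricPart B z z).re + (hermitianPart B z z).re := fun z => by
    rw [← add_re, symmetricPart_add_hermitianPart, leviCovector_re]
  -- For the hyperbolic pair, the Levi form of `A_p(v) u - A_p(u) v` is `-2 Re(conj(A_p v) A_p u)`,
  -- a real quadratic form in `p` that vanishes with `B p p`.
  obtain ⟨c, hc⟩ := exists_eq_mul_of_zeros B
    (LinearMap.mk₂ ℝ
      (fun p q : E => (conj (leviCovector B p v) * leviCovector B q u).re)
      (fun p p' q => by simp only [leviCovector_add, map_add, add_mul, add_re])
      (fun t p q => by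
        simp only [leviCovector_smul, map_mul, conj_ofReal, mul_assoc, re_ofReal_mul, smul_eq_mul])
      (fun p q q' => by simp only [leviCovector_add, mul_add, add_re])
      (fun t p q => by
        simp only [leviCovector_smul, mul_left_comm _ (t : ℂ), re_ofReal_mul, smul_eq_mul]))
    hB (fun p hp => by
      have h := congrArg re (hlevi p u v hp)
      simp only [sub_eq_add_neg, ← neg_smul, hermitianPart_add_left hB,
        hermitianPart_smul_left hB, map_add, map_smul, smul_eq_mul, huu, hvv, huv, hvu] at h
      simp at h
      simp
      linarith) ha hb
  simp only [LinearMap.mk₂_apply] at hc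
  set s₁ := symmetricPart B u u with hs₁
  set s₂ := symmetricPart B u v with hs₂
  set s₃ := symmetricPart B v v with hs₃
  have hs₂' : symmetricPart B v u = s₂ := symmetricPart_symm hB v u
  have hAu : ∀ x y : ℂ, leviCovector B (x • u + y • v) u = s₁ * x + s₂ * y + conj y := by
    intro x y
    rw [← symmetricPart_add_hermitianPart]
    simp only [map_add, map_smul, LinearMap.add_apply, LinearMap.smul_apply, smul_eq_mul,
      hermitianPart_add_left hB, hermitianPart_smul_left hB, huu, hvu, hs₂', ← hs₁]
    ring
  have hAv : ∀ x y : ℂ, leviCovector B (x • u + y • v) v = s₂ * x + s₃ * y + conj x := by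
    intro x y
    rw [← symmetricPart_add_hermitianPart]
    simp only [map_add, map_smul, LinearMap.add_apply, LinearMap.smul_apply, smul_eq_mul,
      hermitianPart_add_left hB, hermitianPart_smul_left hB, huv, hvv, ← hs₂, ← hs₃]
    ring
  have hli := linearIndependent_hyperbolic hB huu hvv huv he0 he
  have hspan : ∀ z, ∃ x y t : ℂ, z = x • u + y • v + t • e := by
    intro z
    let b := basisOfLinearIndependentOfCardEqFinrank hli (by simp [hdim])
    refine ⟨b.repr z 0, b.repr z 1, b.repr z 2, ?_⟩
    have := (b.sum_repr z).symm
    simpa [b, Fin.sum_univ_three] using this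
  obtain ⟨h₁, h₂, h₃⟩ : s₁ = 0 ∧ s₂ = 0 ∧ s₃ = 0 := by
    refine binary_levi (c := c) (fun x y => ?_) (fun x y hu hv => ?_)
    · have h := hc (x • u + y • v)
      rw [hAu, hAv, hform] at h
      rw [h]
      congr 1
      simp only [map_add, map_smul, LinearMap.add_apply, LinearMap.smul_apply, smul_eq_mul,
        hermitianPart_add_left hB, hermitianPart_smul_left hB, huu, hvv, huv, hvu, hs₂',
        ← hs₁, ← hs₂, ← hs₃]
      simp [pow_two]
      ring
    · rw [← hAu] at hu
      rw [← hAv] at hv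
      have hker : x • u + y • v ∈ Submodule.span ℂ {e} := by
        refine hes _ fun z => apply_eq_zero_of_leviCovector_eq_zero (fun z => ?_) z
        obtain ⟨x', y', t', rfl⟩ := hspan z
        simp [hu, hv, leviCovector_right_of_mem_ker hB he]
      obtain ⟨t, ht⟩ := Submodule.mem_span_singleton.1 hker
      have := Fintype.linearIndependent_iff.1 hli ![x, y, -t]
        (by simp [Fin.sum_univ_three, ht])
      exact ⟨this 0, this 1⟩
  -- The factor `-i` turns `2 Re(x̄ y)` into `2 Im(x ȳ)`, the equation of `Q24`.
  have hli' : LinearIndependent ℂ ![(-I) • u, v, e] := by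
    refine linearIndependent_of_top_le_span_of_card_eq_finrank (fun z _ => ?_) (by simp [hdim])
    obtain ⟨x, y, t, rfl⟩ := hspan z
    rw [show x • u = (I * x) • ((-I) • u) by
      rw [smul_smul]; congr 1; linear_combination x * I_sq]
    refine Submodule.add_mem _ (Submodule.add_mem _ ?_ ?_) ?_ <;>
      refine Submodule.smul_mem _ _ (Submodule.subset_span ?_)
    · exact ⟨0, rfl⟩
    · exact ⟨1, rfl⟩
    · exact ⟨2, rfl⟩
  refine ⟨basisOfLinearIndependentOfCardEqFinrank hli' (by simp [hdim]), fun z => ?_⟩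
  set b' := basisOfLinearIndependentOfCardEqFinrank hli' (by simp [hdim]) with hb'
  have hz : z = b'.repr z 0 • ((-I) • u) + b'.repr z 1 • v + b'.repr z 2 • e := by
    have := (b'.sum_repr z).symm
    simpa [hb', Fin.sum_univ_three] using this
  generalize b'.repr z 0 = x at *
  generalize b'.repr z 1 = y at *
  generalize b'.repr z 2 = t at *
  rw [hform, hz]
  simp only [map_add, map_smul, LinearMap.add_apply, LinearMap.smul_apply, smul_eq_mul,
    hermitianPart_add_left hB, hermitianPart_smul_left hB, huu, hvv, huv, hvu, hs₂',
    ← hs₁, ← hs₂, ← hs₃, h₁, h₂, h₃, hse, hse', hhe, hhe']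
  simp
  ring

end Dimension3

/-! ### Polynomials of degree at most two as quadratic functions. -/

section Polynomial

open MvPolynomial

/-- Real polynomials of degree at most two are sums of a constant, a linear form and a
quadratic form. -/
lemma exists_eval_eq_of_totalDegree_le_two {σ : Type*} (P : MvPolynomial σ ℝ)
    (hP : P.totalDegree ≤ 2) :
    ∃ (a : ℝ) (l : (σ → ℝ) →ₗ[ℝ] ℝ) (B : (σ → ℝ) →ₗ[ℝ] (σ → ℝ) →ₗ[ℝ] ℝ),
      ∀ x, eval x P = a + l x + B x x := by
  have hmon : ∀ (k : ℕ) (d : σ →₀ ℕ), d.degree = k + 1 →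
      ∃ (i : σ) (d' : σ →₀ ℕ), d'.degree = k ∧ d = Finsupp.single i 1 + d' := by
    intro k d hd
    obtain ⟨i, hi⟩ : ∃ i, d i ≠ 0 := by
      by_contra! h
      rw [show d = 0 from Finsupp.ext h, map_zero] at hd
      omega
    have hle : Finsupp.single i 1 ≤ d := by
      rw [Finsupp.single_le_iff]; omega
    have hsum := add_tsub_cancel_of_le hle
    refine ⟨i, d - Finsupp.single i 1, ?_, hsum.symm⟩
    have := congrArg Finsupp.degree hsum
    rw [map_add, Finsupp.degree_single, hd] at this
    omega
  have hsum : ∀ s ⊆ P.support, ∃ (a : ℝ) (l : (σ → ℝ) →ₗ[ℝ] ℝ)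
      (B : (σ → ℝ) →ₗ[ℝ] (σ → ℝ) →ₗ[ℝ] ℝ),
      ∀ x, eval x (∑ d ∈ s, monomial d (P.coeff d)) = a + l x + B x x := by
    classical
    intro s
    induction s using Finset.induction_on with
    | empty => exact fun _ => ⟨0, 0, 0, by simp⟩
    | insert d s hd ih =>
      intro hs
      obtain ⟨a, l, B, h⟩ := ih ((Finset.subset_insert _ _).trans hs)
      have hdeg : d.degree ≤ 2 :=
        (le_totalDegree (hs (Finset.mem_insert_self _ _))).trans hP
      simp only [Finset.sum_insert hd, map_add, h]
      set r := P.coeff d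
      obtain h0 | h1 | h2 : d.degree = 0 ∨ d.degree = 1 ∨ d.degree = 2 := by omega
      · rw [Finsupp.degree_eq_zero_iff] at h0
        exact ⟨r + a, l, B, fun x => by simp [h0]; ring⟩
      · obtain ⟨i, d', hd', rfl⟩ := hmon 0 d h1
        rw [Finsupp.degree_eq_zero_iff] at hd'
        subst hd'
        exact ⟨a, r • LinearMap.proj i + l, B, fun x => by
          simp [eval_monomial]; ring⟩
      · obtain ⟨i, d', hd', rfl⟩ := hmon 1 d h2
        obtain ⟨j, d'', hd'', rfl⟩ := hmon 0 d' hd'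
        rw [Finsupp.degree_eq_zero_iff] at hd''
        subst hd''
        exact ⟨a, l, r • (LinearMap.proj i : (σ → ℝ) →ₗ[ℝ] ℝ).smulRight
          (LinearMap.proj j : (σ → ℝ) →ₗ[ℝ] ℝ) + B, fun x => by
          simp [eval_monomial, Finsupp.prod_add_index', pow_add]; ring⟩
  simpa [← P.as_sum] using hsum P.support subset_rfl

end Polynomial

/-! ### From the analytic hypotheses to conditions on the bilinear form. -/

section Calculus

variable {n : ℕ}

/-- `z ↦ (Re z, Im z)` as a real-linear map. -/
def realCoordsLinear (n : ℕ) : (Fin n → ℂ) →ₗ[ℝ] (Fin n ⊕ Fin n → ℝ) where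
  toFun := realCoords
  map_add' x y := by ext (i | i) <;> simp [realCoords]
  map_smul' x y := by ext (i | i) <;> simp [realCoords]

lemma hasFDerivAt_quadratic {E : Type*} [NormedAddCommGroup E] [NormedSpace ℝ E]
    [FiniteDimensional ℝ E] (B : E →ₗ[ℝ] E →ₗ[ℝ] ℝ) (p : E) :
    HasFDerivAt (fun z => B z z)
      (LinearMap.toContinuousLinearMap (B p + B.flip p)) p := by
  have h := (B.toContinuousBilinearMap).isBoundedBilinearMap.hasFDerivAt (p, p)
  refine (h.comp (f := fun z => (z, z)) p
    ((hasFDerivAt_id p).prodMk (hasFDerivAt_id p))).congr_fderiv ?_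
  ext v
  simp

/-- A quadratic function with a critical zero at the origin is a quadratic form. -/
lemma exists_bilinear {F : (Fin n → ℂ) → ℝ} (hF : IsQuadratic F) (h0 : F 0 = 0)
    (hd : fderiv ℝ F 0 = 0) :
    ∃ B : (Fin n → ℂ) →ₗ[ℝ] (Fin n → ℂ) →ₗ[ℝ] ℝ, (∀ x y, B x y = B y x) ∧
      ∀ z, F z = B z z := by
  obtain ⟨P, hP, hFP⟩ := hF
  obtain ⟨a, l, B, h⟩ := exists_eval_eq_of_totalDegree_le_two P hP.le
  let R := realCoordsLinear n
  let l' := l ∘ₗ R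
  let B' := B.compl₁₂ R R
  have hF' : ∀ z, F z = a + l' z + B' z z := fun z => (hFP z).trans (h _)
  have ha : a = 0 := by simpa [h0] using (hF' 0).symm
  have hl : l' = 0 := by
    have hder : HasFDerivAt F (LinearMap.toContinuousLinearMap l' +
        LinearMap.toContinuousLinearMap (B' 0 + B'.flip 0)) 0 := by
      rw [show F = fun z => l' z + B' z z by ext z; rw [hF', ha, zero_add]]
      exact (LinearMap.toContinuousLinearMap l').hasFDerivAt.add (hasFDerivAt_quadratic B' 0)
    have := hder.fderiv.symm.trans hd
    refine LinearMap.ext fun v => ?_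
    simpa using congrArg (fun f => f v) this
  refine ⟨(1 / 2 : ℝ) • (B' + B'.flip), fun x y => ?_, fun z => ?_⟩
  · simp [add_comm]
  · rw [hF', ha, hl]
    simp
    ring

variable {F : (Fin n → ℂ) → ℝ} {B : (Fin n → ℂ) →ₗ[ℝ] (Fin n → ℂ) →ₗ[ℝ] ℝ}

lemma fderiv_quadratic (hB : ∀ x y, B x y = B y x) (hF : ∀ z, F z = B z z)
    (p v : Fin n → ℂ) : fderiv ℝ F p v = 2 * B p v := by
  rw [show F = fun z => B z z from funext hF, (hasFDerivAt_quadratic B p).fderiv]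
  simp [hB v p]
  ring

lemma fderiv_quadratic_eq_zero_iff (hB : ∀ x y, B x y = B y x) (hF : ∀ z, F z = B z z)
    (p : Fin n → ℂ) : fderiv ℝ F p = 0 ↔ ∀ v, B p v = 0 := by
  simp [ContinuousLinearMap.ext_iff, fderiv_quadratic hB hF]

lemma mem_leviDistribution_iff (hB : ∀ x y, B x y = B y x) (hF : ∀ z, F z = B z z)
    (p v : Fin n → ℂ) : v ∈ leviDistribution F p ↔ leviCovector B p v = 0 := by
  have : del F p v = leviCovector B p v := by
    simp only [del, fderiv_quadratic hB hF, leviCovector_apply]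
    push_cast
    ring
  rw [leviDistribution, Set.mem_ofPred_eq, this]

/-- Every point has a nonzero real multiple in a given neighbourhood of the origin. -/
lemma exists_smul_mem {U : Set (Fin n → ℂ)} (hU : IsOpen U) (h0 : 0 ∈ U) (z : Fin n → ℂ) :
    ∃ t : ℝ, t ≠ 0 ∧ t • z ∈ U := by
  have hc : Filter.Tendsto (fun t : ℝ => t • z) (nhdsWithin 0 {0}ᶜ) (nhds 0) := by
    have : Continuous fun t : ℝ => t • z := by fun_prop
    simpa using (this.tendsto 0).mono_left nhdsWithin_le_nhds
  obtain ⟨t, ht, ht'⟩ := ((hc.eventually (hU.mem_nhds h0)).and self_mem_nhdsWithin).exists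
  exact ⟨t, ht', ht⟩

/-- The kernel of the quadratic form is the line of singular points. -/
lemma mem_complexLine_iff (hB : ∀ x y, B x y = B y x) (hF : ∀ z, F z = B z z)
    {U : Set (Fin n → ℂ)} (hU : IsOpen U) (h0 : 0 ∈ U)
    (hsing : singularSet F U = complexLine n ∩ U) (z : Fin n → ℂ) :
    z ∈ complexLine n ↔ ∀ v, B z v = 0 := by
  obtain ⟨t, ht, htU⟩ := exists_smul_mem hU h0 z
  have h1 : t • z ∈ complexLine n ↔ z ∈ complexLine n := by
    simp [complexLine, ht]
  have h2 : t • z ∈ singularSet F U ↔ ∀ v, B z v = 0 := by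
    simp only [singularSet, zeroSet, Set.mem_ofPred_eq, fderiv_quadratic_eq_zero_iff hB hF, htU,
      hF, true_and]
    simp only [map_smul, LinearMap.smul_apply, smul_eq_mul, mul_eq_zero, ht, false_or]
    exact ⟨fun h => h.2, fun h => ⟨h z, h⟩⟩
  rw [← h1, ← h2, hsing]
  simp [htU]

/-- The Levi form vanishes along the fields `∂F(p)(w) v - ∂F(p)(v) w` tangent to the Levi
distribution. -/
lemma levi_condition (hB : ∀ x y, B x y = B y x) (hF : ∀ z, F z = B z z)
    {U : Set (Fin n → ℂ)} (hU : IsOpen U) (h0 : 0 ∈ U) (hflat : IsLeviFlat F U)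
    (p v w : Fin n → ℂ) (hp : B p p = 0) :
    hermitianPart B (leviCovector B p w • v - leviCovector B p v • w)
      (leviCovector B p w • v - leviCovector B p v • w) = 0 := by
  let X : (Fin n → ℂ) →ₗ[ℝ] (Fin n → ℂ) :=
    { toFun := fun p => leviCovector B p w • v - leviCovector B p v • w
      map_add' := fun p q => by
        simp only [leviCovector_add, add_smul]; abel
      map_smul' := fun t p => by
        simp only [leviCovector_smul, mul_smul, RingHom.id_apply, smul_sub]
        rfl }
  -- `X` and `Y = i X` are real-linear fields tangent to the Levi distribution at every point, and
  -- their bracket computes the Levi form of `X p`.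
  let Y : (Fin n → ℂ) →ₗ[ℝ] (Fin n → ℂ) := (I • LinearMap.id) ∘ₗ X
  have hXt : ∀ q, leviCovector B q (X q) = 0 := fun q => by
    simp [X, mul_comm]
  have hX : ∀ q u, leviCovector B q (X u) =
      leviCovector B u w * leviCovector B q v - leviCovector B u v * leviCovector B q w :=
    fun q u => by simp [X]
  change hermitianPart B (X p) (X p) = 0
  by_cases hreg : ∀ v, B p v = 0
  · have : X p = 0 := by simp [X, leviCovector_eq_zero hreg]
    rw [this, map_zero]
  obtain ⟨t, ht, htU⟩ := exists_smul_mem hU h0 p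
  have hmem : t • p ∈ regularPart F U ∩ Set.univ := by
    refine ⟨⟨⟨htU, by simp [hF, hp]⟩, ?_⟩, trivial⟩
    rw [Ne, fderiv_quadratic_eq_zero_iff hB hF]
    simpa [ht] using hreg
  have hbr := hflat Set.univ X Y isOpen_univ
    (LinearMap.toContinuousLinearMap X).contDiff.contDiffOn
    (LinearMap.toContinuousLinearMap Y).contDiff.contDiffOn
    (fun q _ => by
      simp only [mem_leviDistribution_iff hB hF]
      exact ⟨hXt q, by simp [Y, hXt q]⟩) _ hmem
  rw [mem_leviDistribution_iff hB hF, VectorField.lieBracket,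
    show fderiv ℝ X = fun _ => LinearMap.toContinuousLinearMap X from
      funext fun q => (LinearMap.toContinuousLinearMap X).fderiv,
    show fderiv ℝ Y = fun _ => LinearMap.toContinuousLinearMap Y from
      funext fun q => (LinearMap.toContinuousLinearMap Y).fderiv] at hbr
  -- By `hX`, `A_q(X u) = -A_u(X q)`. Exchanging arguments turns the left side into `-i A_{Xp}(Xp) +
  -- A_{iXp}(Xp)`, which is `-2i H(Xp,Xp)`.
  have hbr' : I * leviCovector B p (X (X p)) - leviCovector B p (X (I • X p)) = 0 := by
    simpa [Y, leviCovector_smul, ht, ← mul_sub] using hbr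
  have e1 := hX (X p) p
  have e2 := hX (I • X p) p
  have e3 := hX p (X p)
  have e4 := hX p (I • X p)
  rw [hermitianPart_apply]
  linear_combination (1 / 2) * e1 + (1 / 2) * I * e2 + (1 / 2) * I * (hbr' - I * e3 + e4) +
    1 / 2 *
      (leviCovector B p w * leviCovector B (X p) v - leviCovector B p v * leviCovector B (X p) w) *
        I_sq

end Calculus

/-! ### Complex linear normal forms and the resulting biholomorphisms. -/

lemma mem_complexLine_succ {m : ℕ} {z : Fin (m + 1) → ℂ} :
    z ∈ complexLine (m + 1) ↔ ∀ i : Fin m, z i.castSucc = 0 := by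
  simp only [complexLine, Set.mem_ofPred_eq, add_tsub_cancel_right]
  exact ⟨fun h i => h _ i.2, fun h i hi => h ⟨i, hi⟩⟩

/-- A linear automorphism of the first `m` coordinates, extended by the identity on the last. -/
def snocLinearEquiv {m : ℕ} (e : (Fin m → ℂ) ≃ₗ[ℂ] (Fin m → ℂ)) :
    (Fin (m + 1) → ℂ) ≃ₗ[ℂ] (Fin (m + 1) → ℂ) where
  toFun z := Fin.snoc (α := fun _ => ℂ) (e fun i => z i.castSucc) (z (Fin.last m))
  invFun z := Fin.snoc (α := fun _ => ℂ) (e.symm fun i => z i.castSucc) (z (Fin.last m))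
  map_add' x y := by
    ext i
    refine Fin.lastCases ?_ (fun j => ?_) i
    · simp
    · simp only [Fin.snoc_castSucc, Pi.add_apply]
      exact congrFun (map_add e (fun i => x i.castSucc) (fun i => y i.castSucc)) j
  map_smul' c x := by
    ext i
    refine Fin.lastCases ?_ (fun j => ?_) i
    · simp
    · simp only [Fin.snoc_castSucc, Pi.smul_apply]
      exact congrFun (map_smul e c (fun i => x i.castSucc)) j
  left_inv x := by
    ext i
    refine Fin.lastCases ?_ (fun j => ?_) i <;> simp
  right_inv x := by
    ext i
    refine Fin.lastCases ?_ (fun j => ?_) i <;> simp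

/-- A complex quadratic form whose kernel is the last coordinate axis is linearly equivalent to
the sum of the squares of the other coordinates. -/
lemma exists_linearEquiv_sum_squares {m : ℕ}
    (s : (Fin (m + 1) → ℂ) →ₗ[ℂ] (Fin (m + 1) → ℂ) →ₗ[ℂ] ℂ) (hs : ∀ x y, s x y = s y x)
    (hker : ∀ z, z ∈ complexLine (m + 1) ↔ ∀ v, s z v = 0) :
    ∃ Φ : (Fin (m + 1) → ℂ) ≃ₗ[ℂ] (Fin (m + 1) → ℂ),
      ∀ z, s z z = ∑ i : Fin (m + 1), if (i : ℕ) < m then Φ z i ^ 2 else 0 := by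
  let ι : (Fin m → ℂ) →ₗ[ℂ] (Fin (m + 1) → ℂ) :=
    LinearMap.pi fun i => Fin.lastCases (motive := fun _ => (Fin m → ℂ) →ₗ[ℂ] ℂ) 0
      (fun j => LinearMap.proj j) i
  have hιc : ∀ x (i : Fin m), ι x i.castSucc = x i := fun x i => by simp [ι]
  -- `k v` is the component of `v` on the last axis, the kernel of `s`; so `s` is determined by its
  -- restriction `b` to the first `m` coordinates.
  let k : (Fin (m + 1) → ℂ) → (Fin (m + 1) → ℂ) := fun v => v - ι fun i => v i.castSucc
  have hk : ∀ v w, s (k v) w = 0 := fun v => (hker _).1 (mem_complexLine_succ.2 fun i => by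
    simp [k, hιc])
  have hk' : ∀ v w, s w (k v) = 0 := fun v w => (hs _ _).trans (hk v w)
  have hdec : ∀ v, v = (ι fun i => v i.castSucc) + k v := fun v => by simp [k]
  let b : LinearMap.BilinForm ℂ (Fin m → ℂ) := s.compl₁₂ ι ι
  let d : LinearMap.BilinForm ℂ (Fin m → ℂ) := dotProductBilin ℂ ℂ
  have hb : QuadraticMap.associated (LinearMap.BilinMap.toQuadraticMap b) = b :=
    QuadraticMap.associated_left_inverse ℂ fun x y => hs _ _
  have hd : QuadraticMap.associated (LinearMap.BilinMap.toQuadraticMap d) = d :=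
    QuadraticMap.associated_left_inverse ℂ fun x y => by simp [d, dotProduct_comm]
  -- Over `ℂ`, nondegenerate quadratic forms on the same space are equivalent; the target is the dot
  -- product.
  obtain ⟨e⟩ := QuadraticForm.equivalent_of_isAlgClosed (LinearMap.BilinMap.toQuadraticMap b)
    (LinearMap.BilinMap.toQuadraticMap d)
    (by
      rw [hb]
      intro x hx
      have h : ι x ∈ complexLine (m + 1) := (hker _).2 fun v => by
        rw [hdec v, map_add, hk', add_zero]
        exact hx _
      ext i
      rw [← hιc x i]
      exact mem_complexLine_succ.1 h i)
    (by
      rw [hd]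
      intro x hx
      ext i
      simpa [d] using hx (Pi.single i 1))
  refine ⟨snocLinearEquiv e.toLinearEquiv, fun z => ?_⟩
  have h1 : s z z = b (fun i => z i.castSucc) (fun i => z i.castSucc) := by
    conv_lhs => rw [hdec z]
    simp only [map_add, LinearMap.add_apply, hk, hk', add_zero]
    rfl
  have h2 := e.map_app fun i => z i.castSucc
  rw [LinearMap.BilinMap.toQuadraticMap_apply, LinearMap.BilinMap.toQuadraticMap_apply] at h2
  rw [h1, ← h2, Fin.sum_univ_castSucc]
  simp [d, dotProduct, snocLinearEquiv, pow_two]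

/-- A complex linear automorphism that identifies the equations identifies the hypersurfaces. -/
lemma biholomorphicTo_of_linearEquiv {n : ℕ} {F : (Fin n → ℂ) → ℝ} {U Q : Set (Fin n → ℂ)}
    (Φ : (Fin n → ℂ) ≃ₗ[ℂ] (Fin n → ℂ)) (h : ∀ z, F z = 0 ↔ Φ z ∈ Q) :
    BiholomorphicTo U (zeroSet F U) Q := by
  refine ⟨Φ.toEquiv, (LinearMap.toContinuousLinearMap Φ.toLinearMap).differentiable,
    (LinearMap.toContinuousLinearMap Φ.symm.toLinearMap).differentiable, map_zero Φ, ?_⟩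
  ext w
  constructor
  · rintro ⟨z, ⟨hz, hz'⟩, rfl⟩
    exact ⟨(h z).1 hz', z, hz, rfl⟩
  · rintro ⟨hw, z, hz, rfl⟩
    exact ⟨z, ⟨hz, (h z).2 hw⟩, rfl⟩

/-- If the Hermitian part vanishes, the hypersurface is the real part of a complex quadric. -/
lemma biholomorphicTo_Q0 {n : ℕ} (hn : 1 ≤ n) {F : (Fin n → ℂ) → ℝ} {U : Set (Fin n → ℂ)}
    {B : (Fin n → ℂ) →ₗ[ℝ] (Fin n → ℂ) →ₗ[ℝ] ℝ} (hB : ∀ x y, B x y = B y x)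
    (hF : ∀ z, F z = B z z) (hker : ∀ z, z ∈ complexLine n ↔ ∀ v, B z v = 0)
    (hh : ∀ x y, hermitianPart B x y = 0) :
    BiholomorphicTo U (zeroSet F U) (Q0 n (n - 1)) := by
  obtain ⟨m, rfl⟩ : ∃ m, n = m + 1 := ⟨n - 1, by omega⟩
  have hs : ∀ x y, symmetricPart B x y = leviCovector B x y := fun x y => by
    rw [← symmetricPart_add_hermitianPart, hh, add_zero]
  obtain ⟨Φ, hΦ⟩ := exists_linearEquiv_sum_squares (symmetricPart B) (symmetricPart_symm hB)
    (fun z => by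
      simp only [hker, hs]
      exact ⟨leviCovector_eq_zero, apply_eq_zero_of_leviCovector_eq_zero⟩)
  refine biholomorphicTo_of_linearEquiv Φ fun z => ?_
  rw [Q0, Set.mem_ofPred_eq, add_tsub_cancel_right, ← hΦ, hs, leviCovector_re, hF]

lemma mem_Q24_iff {n : ℕ} (hn : 2 ≤ n) (z : Fin n → ℂ) :
    z ∈ Q24 n hn ↔ (z ⟨0, by omega⟩ * conj (z ⟨1, by omega⟩)).im = 0 := by
  rw [Q24, Set.mem_ofPred_eq, Complex.ext_iff]
  simp
  constructor <;> intro h <;> linarith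

end LeviFlat

open LeviFlat

theorem mainTheorem4 (n : ℕ) (hn : 3 ≤ n) (U : Set (Fin n → ℂ)) (hU : IsOpen U)
    (h0 : (0 : Fin n → ℂ) ∈ U) (F : (Fin n → ℂ) → ℝ)
    (hquad : LeviFlat.IsQuadratic F)
    (hhyp : (LeviFlat.regularPart F U).Nonempty)
    (hflat : LeviFlat.IsLeviFlat F U)
    (hsing : LeviFlat.singularSet F U = LeviFlat.complexLine n ∩ U) :
    (n = 3 →
      LeviFlat.BiholomorphicTo U (LeviFlat.zeroSet F U) (LeviFlat.Q0 n 2) ∨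
      LeviFlat.BiholomorphicTo U (LeviFlat.zeroSet F U) (LeviFlat.Q24 n (by omega))) ∧
    (4 ≤ n → LeviFlat.BiholomorphicTo U (LeviFlat.zeroSet F U) (LeviFlat.Q0 n (n - 1))) := by
  have hs0 : (0 : Fin n → ℂ) ∈ singularSet F U := by
    rw [hsing]
    exact ⟨fun i _ => rfl, h0⟩
  obtain ⟨B, hB, hF⟩ := exists_bilinear hquad hs0.1.2 hs0.2
  have hker := mem_complexLine_iff hB hF hU h0 hsing
  have hlevi := levi_condition hB hF hU h0 hflat
  obtain ⟨p, ⟨-, hp⟩, hpd⟩ := hhyp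
  rw [hF] at hp
  rw [Ne, fderiv_quadratic_eq_zero_iff hB hF, not_forall] at hpd
  obtain ⟨q, hpq⟩ := hpd
  -- The last basis vector spans the singular line, which is the kernel of `B`.
  let e : Fin n → ℂ := Pi.single ⟨n - 1, by omega⟩ 1
  have he0 : e ≠ 0 := by simp [e]
  have hespan : ∀ w, (∀ v, B w v = 0) → w ∈ Submodule.span ℂ {e} := by
    intro w hw
    refine Submodule.mem_span_singleton.2 ⟨w ⟨n - 1, by omega⟩, ?_⟩
    ext i
    by_cases hi : (i : ℕ) < n - 1
    · rw [(hker w).2 hw i hi]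
      simp [e, Fin.ext_iff, hi.ne]
    · have hlast : i = ⟨n - 1, by omega⟩ := Fin.ext (by simp; omega)
      simp [e, hlast]
  have heker : ∀ c : ℂ, ∀ x, B (c • e) x = 0 := fun c =>
    (hker _).1 fun i hi => by simp [e, Fin.ext_iff, hi.ne]
  constructor
  · rintro rfl
    by_cases hh : ∀ x y, hermitianPart B x y = 0
    · exact Or.inl (biholomorphicTo_Q0 (by norm_num) hB hF hker hh)
    · push Not at hh
      obtain ⟨x, y, hxy⟩ := hh
      obtain ⟨b, hb⟩ := exists_basis_hyperbolic hB hlevi hp hpq (by simp) he0 hespan heker hxy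
      refine Or.inr (biholomorphicTo_of_linearEquiv b.equivFun fun z => ?_)
      rw [hF, hb, mem_Q24_iff]
      simp
  · intro hn4
    exact biholomorphicTo_Q0 (by omega) hB hF hker
      (hermitianPart_eq_zero hB hlevi hp hpq (by simpa using hn4) hespan)
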